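/- Let $\alpha$ be an ordinal, equip the ordinal $\omega^{\alpha+1}$ (the set of all ordinals less than $\omega^{\alpha+1}$) with its order topology, and let $\mathrm{Homeo}(\omega^{\alpha+1})$ be the group of its self-homeomorphisms. Let $M_\alpha \subset \omega^{\alpha+1}$ be the set of elements of maximal (Cantor–Bendixson) rank: $M_\alpha = \{\omega^\alpha\cdot k : k \in \mathbb{N},\ k \ge 1\}$ if $\alpha \ge 1$, and $M_0 = \omega$. An element $g$ of a group $G$ normally generates $G$ if every element of $G$ is a product of conjugates of $g$ and $g^{-1}$; it uniformly normally generates $G$ if there is an integer $k \ge 1$ such that every element of $G$ is a product of at most $k$ conjugates of $g$ and $g^{-1}$, and the least such $k$ is the $g$-width of $G$. Every $h \in \mathrm{Homeo}(\omega^{\alpha+1})$ restricts to a permutation of $M_\alpha$, and the following are equivalent: 1. $h$ normally generates $\mathrm{Homeo}(\omega^{\alpha+1})$; 2. $h$ uniformly normally generates $\mathrm{Homeo}(\omega^{\alpha+1})$; 3. $h$ induces an infinite permutation of $M_\alpha$, that is, $h(x) \ne x$ for infinitely many $x \in M_\alpha$. Moreover, if any of these conditions holds, then the $h$-width of $\mathrm{Homeo}(\omega^{\alpha+1})$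 is at most $12$. -/

import Mathlib

open scoped Ordinal

universe u

section NormalGeneration

variable {G : Type u} [Group G]

/-- `f` is a product of the entries of the list `l`, each of which is a conjugate of `g` or of
`g⁻¹`. -/
def IsConjProduct (g f : G) (l : List G) : Prop :=
  (∀ x ∈ l, IsConj g x ∨ IsConj g⁻¹ x) ∧ l.prod = f

/-- Every element of `G` is a product of conjugates of `g` and `g⁻¹`. -/
def NormallyGenerates (g : G) : Prop :=
  ∀ f : G, ∃ l : List G, IsConjProduct g f l

/-- Every element of `G` is a product of at most `k` conjugates of `g` and `g⁻¹`. -/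
def NormallyGeneratesWithin (g : G) (k : ℕ) : Prop :=
  ∀ f : G, ∃ l : List G, l.length ≤ k ∧ IsConjProduct g f l

/-- There is a positive `k` such that every element of `G` is a product of at most `k` conjugates
of `g` and `g⁻¹`. -/
def UniformlyNormallyGenerates (g : G) : Prop :=
  ∃ k : ℕ, 0 < k ∧ NormallyGeneratesWithin g k

/-- The `g`-width of `G`: the least positive `k` such that every element of `G` is a product of at
most `k` conjugates of `g` and `g⁻¹`; it is `⊤` if there is no such `k`. -/
noncomputable def normalWidth (g : G) : ℕ∞ :=
  ⨅ (k : ℕ) (_ : 0 < k ∧ NormallyGeneratesWithin g k), (k : ℕ∞)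

end NormalGeneration

/-- The ordinal `ω ^ (α + 1)`, as the set of all smaller ordinals. Its topology is the subspace
topology from `Ordinal`, which is the order topology because initial segments are order-convex. -/
abbrev OmegaSucc (α : Ordinal.{u}) : Type (u + 1) :=
  Set.Iio (ω ^ (α + 1) : Ordinal.{u})

/-- The points of maximal (Cantor-Bendixson) rank of `ω ^ (α + 1)`: for `α ≠ 0` these are the
`ω ^ α * k` with `k ≥ 1`; for `α = 0` the space is the discrete space `ω`, and all its points,
including `0`, have maximal rank. -/
def maxRankPoints (α : Ordinal.{u}) : Set (OmegaSucc α) :=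
  {x | ∃ k : ℕ, (x : Ordinal.{u}) = ω ^ α * (k : Ordinal.{u}) ∧ (k ≠ 0 ∨ α = 0)}

/-- `h` restricts to a permutation of the set `M`, and this permutation moves infinitely many
points. -/
def InducesInfinitePermutation {X : Type u} [TopologicalSpace X] (h : X ≃ₜ X) (M : Set X) : Prop :=
  Set.BijOn h M M ∧ {x ∈ M | h x ≠ x}.Infinite

/-! ### Cantor-Bendixson rank on ordinals -/

section CantorBendixson

open Topology Filter Set

universe v w

/-! Write `X` for `ω ^ (α + 1)` and `M` for its points of maximal rank; call a clopen set large if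
it contains infinitely many points of `M`. Rank is topological, so homeomorphisms preserve `M`.
Cutting a large set just after each of its points of `M` yields countably many compact well-ordered
blocks, all homeomorphic to one block `T`. Hence every large set is a copy of `ℕ × T`, and so also
of `ℤ × X` (`nonempty_homeomorph_nat_prod`, `IsBlockSpace.nonempty_homeomorph_int_prod`).

If `h` moves infinitely many points of `M`, some large `A` is disjoint from its image under `h`.
Identify `A` with `ℤ × X`. A homeomorphism supported on one slice is a commutator of two
homeomorphisms supported on `A`, by an infinite telescoping product along the shift. Since `h`
displaces `A`, such a commutator is a product of four conjugates of `h` and `h⁻¹`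
(`exists_isConjProduct_of_slices`). Any homeomorphism fixing pointwise a large set with large
complement can be conjugated into a slice, and every homeomorphism is a product of two of these
(`exists_mul_of_fixes`). This gives width at most 8.

Conversely, the homeomorphisms moving only finitely many points of `M` form a proper normal subgroup
(`infinite_moved_of_normallyGenerates`). -/

/-- The points of Cantor-Bendixson rank at least `β`: those which, for every `γ < β`, are
accumulation points of the set of points of rank at least `γ`. -/
def rankAtLeast (Y : Type v) [TopologicalSpace Y] (β : Ordinal.{u}) : Set Y :=
  {y | ∀ γ : Ordinal.{u}, ∀ _ : γ < β, AccPt y (𝓟 (rankAtLeast Y γ))}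
termination_by β

theorem mem_rankAtLeast {Y : Type v} [TopologicalSpace Y] {β : Ordinal.{u}} {y : Y} :
    y ∈ rankAtLeast Y β ↔ ∀ γ < β, AccPt y (𝓟 (rankAtLeast Y γ)) := by
  rw [rankAtLeast]; rfl

/-- Being an accumulation point is a local property, so rank can be computed in any open
neighbourhood; induct on `β`. -/
theorem Topology.IsOpenEmbedding.mem_rankAtLeast_iff {Y : Type v} {Z : Type w}
    [TopologicalSpace Y] [TopologicalSpace Z] {f : Y → Z} (hf : IsOpenEmbedding f)
    (β : Ordinal.{u}) : ∀ y : Y, f y ∈ rankAtLeast Z β ↔ y ∈ rankAtLeast Y β := by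
  induction β using WellFoundedLT.induction with
  | ind β ih =>
    intro y
    rw [mem_rankAtLeast, mem_rankAtLeast]
    refine forall₂_congr fun γ hγ => ?_
    have : rankAtLeast Y γ = f ⁻¹' rankAtLeast Z γ := Set.ext fun z => (ih γ hγ z).symm
    rw [this, ← comap_principal, hf.accPt_comap_iff]

/-- Multiples of `ω ^ γ` accumulate at `x` exactly when `x = ω ^ γ * q` with `q` a limit, and limits
are the nonzero multiples of `ω`. The clause `γ = 0 ∨ z ≠ 0` reflects that `0` is isolated, so it
has rank `0` although every power of `ω` divides it. -/
theorem Ordinal.accPt_multiples_iff (γ x : Ordinal.{u}) :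
    AccPt x (𝓟 {z : Ordinal.{u} | (γ = 0 ∨ z ≠ 0) ∧ ω ^ γ ∣ z}) ↔ x ≠ 0 ∧ ω ^ (γ + 1) ∣ x := by
  have hpos : (0 : Ordinal) < ω ^ γ := Ordinal.opow_pos γ Ordinal.omega0_pos
  rw [SuccOrder.accPt_principal, isMin_iff_eq_bot, Ordinal.bot_eq_zero, Ordinal.opow_add,
    Ordinal.opow_one]
  refine and_congr_right fun hx => ⟨fun H => ?_, ?_⟩
  -- Otherwise no multiple of `ω ^ γ` lies strictly between this one and `x`.
  · have hdiv : ω ^ γ * (x / ω ^ γ) = x := by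
      refine (Ordinal.mul_div_le x _).eq_of_not_lt fun hlt => ?_
      obtain ⟨z, ⟨-, c, rfl⟩, h1, h2⟩ := H _ hlt
      rw [mul_lt_mul_iff_right₀ hpos] at h1
      exact (Ordinal.lt_mul_div_add x hpos.ne').not_ge
        (((mul_add_one _ _).symm.le.trans
          (mul_le_mul_right (Order.add_one_le_of_lt h1) (ω ^ γ))).trans h2.le)
    rw [← hdiv]
    refine mul_dvd_mul_left _ (Ordinal.isSuccPrelimit_iff_omega0_dvd.1 ?_)
    by_contra hq
    obtain ⟨q, hq⟩ := Order.not_isSuccPrelimit_iff.1 hq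
    rw [← hq.succ_eq] at hdiv
    obtain ⟨z, ⟨-, c, rfl⟩, h1, h2⟩ := H (ω ^ γ * q) (by
      rw [← hdiv, mul_lt_mul_iff_right₀ hpos]; exact Order.lt_succ q)
    rw [← hdiv, mul_lt_mul_iff_right₀ hpos] at h2
    rw [mul_lt_mul_iff_right₀ hpos] at h1
    exact (Order.lt_succ_iff.1 h2).not_gt h1
  · rintro ⟨d, rfl⟩ p hp
    have hd : d ≠ 0 := by rintro rfl; simp at hx
    have hlim : Order.IsSuccLimit (ω * d) := by
      rw [Order.isSuccLimit_iff, isMin_iff_eq_bot]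
      exact ⟨by simpa using hd, Ordinal.isSuccPrelimit_iff_omega0_dvd.2 (dvd_mul_right _ _)⟩
    rw [mul_assoc, Ordinal.lt_mul_iff_of_isSuccLimit hlim] at hp
    obtain ⟨c, hc, hpc⟩ := hp
    refine ⟨ω ^ γ * c, ⟨Or.inr ((zero_le).trans_lt hpc).ne', dvd_mul_right _ _⟩, hpc, ?_⟩
    rw [mul_assoc, mul_lt_mul_iff_right₀ hpos]
    exact hc

/-- For limit `β`, the remainder modulo `ω ^ β` is below some `ω ^ γ` with `γ < β`, yet divisible by
it, hence zero. -/
theorem Ordinal.opow_omega0_dvd_of_forall {β x : Ordinal.{u}}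
    (h : ∀ γ < β, ω ^ (γ + 1) ∣ x) : ω ^ β ∣ x := by
  rcases Ordinal.zero_or_succ_or_isSuccLimit β with rfl | ⟨γ, rfl⟩ | hβ
  · simp
  · simpa using h γ (Order.lt_succ γ)
  · rw [Ordinal.dvd_iff_mod_eq_zero]
    have hlt := Ordinal.mod_lt x (Ordinal.opow_pos β Ordinal.omega0_pos).ne'
    obtain ⟨γ, hγ, hlt⟩ := (Ordinal.lt_opow_of_isSuccLimit Ordinal.omega0_ne_zero hβ).1 hlt
    have hd : ω ^ γ ∣ x := (Ordinal.opow_dvd_opow ω (le_self_add)).trans (h γ hγ)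
    rw [← Ordinal.div_add_mod x (ω ^ β), Ordinal.dvd_add_iff
      ((Ordinal.opow_dvd_opow ω hγ.le).trans (dvd_mul_right _ _))] at hd
    by_contra hne
    exact (Ordinal.le_of_dvd hne hd).not_gt hlt

theorem Ordinal.mem_rankAtLeast_iff (β : Ordinal.{u}) :
    ∀ x : Ordinal.{u}, x ∈ rankAtLeast Ordinal.{u} β ↔ (β = 0 ∨ x ≠ 0) ∧ ω ^ β ∣ x := by
  induction β using WellFoundedLT.induction with
  | ind β ih =>
    intro x
    have key : x ∈ rankAtLeast Ordinal.{u} β ↔ ∀ γ < β, x ≠ 0 ∧ ω ^ (γ + 1) ∣ x := by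
      rw [_root_.mem_rankAtLeast]
      refine forall₂_congr fun γ hγ => ?_
      rw [← Ordinal.accPt_multiples_iff, Set.ext (ih γ hγ)]
      rfl
    rw [key]
    constructor
    · intro H
      refine ⟨?_, Ordinal.opow_omega0_dvd_of_forall fun γ hγ => (H γ hγ).2⟩
      rcases eq_or_ne β 0 with h | h
      · exact Or.inl h
      · exact Or.inr (H 0 (pos_iff_ne_zero.2 h)).1
    · rintro ⟨h | h, hd⟩ γ hγ
      · exact absurd hγ (by simp [h])
      · exact ⟨h, (Ordinal.opow_dvd_opow ω (Order.add_one_le_of_lt hγ)).trans hd⟩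

/-- This replaces the arithmetic description of the set by a topological one, which yields its
invariance under open embeddings. -/
theorem maxRankPoints_eq_rankAtLeast (α : Ordinal.{u}) :
    maxRankPoints α = rankAtLeast (OmegaSucc α) α := by
  ext x
  have hpos : (0 : Ordinal) < ω ^ α := Ordinal.opow_pos α Ordinal.omega0_pos
  rw [← (isOpen_Iio.isOpenEmbedding_subtypeVal).mem_rankAtLeast_iff, Ordinal.mem_rankAtLeast_iff]
  constructor
  · rintro ⟨k, hk, hk'⟩
    refine ⟨hk'.symm.imp_right fun h => ?_, hk ▸ dvd_mul_right _ _⟩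
    rw [hk]
    exact mul_ne_zero hpos.ne' (by exact_mod_cast h)
  · rintro ⟨h, c, hc⟩
    have hx : (x : Ordinal) < ω ^ (α + 1) := x.2
    rw [hc, Ordinal.opow_add, Ordinal.opow_one, mul_lt_mul_iff_right₀ hpos,
      Ordinal.lt_omega0] at hx
    obtain ⟨k, rfl⟩ := hx
    refine ⟨k, hc, h.symm.imp_left ?_⟩
    rintro h rfl
    exact h (by simpa using hc)

/-- The increasing enumeration of the points of maximal rank. -/
theorem exists_enumeration_maxRankPoints (α : Ordinal.{u}) :
    ∃ m : ℕ → OmegaSucc α, StrictMono m ∧ Set.range m = maxRankPoints α ∧ ∀ x, ∃ n, x ≤ m n := by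
  have hpos : (0 : Ordinal) < ω ^ α := Ordinal.opow_pos α Ordinal.omega0_pos
  have hlt : ∀ k : ℕ, ω ^ α * (k : Ordinal.{u}) < ω ^ (α + 1) := fun k => by
    rw [Ordinal.opow_add, Ordinal.opow_one, mul_lt_mul_iff_right₀ hpos]
    exact Ordinal.natCast_lt_omega0 k
  let p : ℕ → OmegaSucc α := fun k => ⟨ω ^ α * (k : Ordinal.{u}), hlt k⟩
  have hp : StrictMono p := fun i j hij => by
    change ω ^ α * (i : Ordinal.{u}) < ω ^ α * (j : Ordinal.{u})
    rw [mul_lt_mul_iff_right₀ hpos]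
    exact_mod_cast hij
  have hcof : ∀ x, ∃ n, x ≤ p n := fun x => by
    obtain ⟨x, hx⟩ := x
    have hx' : x < ω ^ (α + 1) := hx
    rw [Ordinal.opow_add, Ordinal.opow_one,
      Ordinal.lt_mul_iff_of_isSuccLimit Ordinal.isSuccLimit_omega0] at hx'
    obtain ⟨c, hc, hxc⟩ := hx'
    obtain ⟨k, rfl⟩ := Ordinal.lt_omega0.1 hc
    exact ⟨k, hxc.le⟩
  rcases eq_or_ne α 0 with h0 | h0
  · refine ⟨p, hp, ?_, hcof⟩
    ext x
    exact ⟨fun ⟨k, hk⟩ => ⟨k, by rw [← hk], Or.inr h0⟩, fun ⟨k, hk, _⟩ => ⟨k, Subtype.ext hk.symm⟩⟩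
  -- For `α ≠ 0` the point `0` is not of maximal rank, so the enumeration starts at `ω ^ α * 1`.
  · refine ⟨fun n => p (n + 1), fun i j hij => hp (Nat.succ_lt_succ hij), ?_, fun x => ?_⟩
    · ext x
      constructor
      · rintro ⟨k, hk⟩
        exact ⟨k + 1, by rw [← hk], Or.inl k.succ_ne_zero⟩
      · rintro ⟨k, hk, hk0⟩
        obtain ⟨j, rfl⟩ := Nat.exists_eq_succ_of_ne_zero (hk0.resolve_right h0)
        exact ⟨j, Subtype.ext hk.symm⟩
    · obtain ⟨n, hn⟩ := hcof x
      exact ⟨n, hn.trans (hp n.lt_succ_self).le⟩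

end CantorBendixson

/-! ### Gluing along locally constant functions -/

section Gluing

open Topology Filter Set

universe v w

variable {Y : Type v} {Z : Type w} [TopologicalSpace Y] [TopologicalSpace Z] {ι : Type*}
  [TopologicalSpace ι] [DiscreteTopology ι]

/-- A space is the disjoint union of the fibres of a locally constant function. -/
noncomputable def sigmaFiberHomeomorph (p : Y → ι) (hp : Continuous p) :
    (Σ i, {y // p y = i}) ≃ₜ Y :=
  (Equiv.sigmaFiberEquiv p).toHomeomorphOfContinuousOpen
    (continuous_sigma fun _ => continuous_subtype_val)
    (isOpenMap_sigma.2 fun i =>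
      ((isOpen_discrete {i}).preimage hp).isOpenMap_subtype_val)

/-- Homeomorphisms between the fibres of two locally constant functions glue. -/
noncomputable def glueHomeomorph (p : Y → ι) (q : Z → ι) (hp : Continuous p) (hq : Continuous q)
    (e : ∀ i, {y // p y = i} ≃ₜ {z // q z = i}) : Y ≃ₜ Z :=
  ((sigmaFiberHomeomorph p hp).symm.trans
    { toEquiv := Equiv.sigmaCongrRight fun i => (e i).toEquiv
      continuous_toFun := continuous_sigma fun i => continuous_sigmaMk.comp (e i).continuous
      continuous_invFun := continuous_sigma fun i =>
        continuous_sigmaMk.comp (e i).symm.continuous }).trans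
    (sigmaFiberHomeomorph q hq)

theorem glueHomeomorph_apply (p : Y → ι) (q : Z → ι) (hp : Continuous p) (hq : Continuous q)
    (e : ∀ i, {y // p y = i} ≃ₜ {z // q z = i}) {i : ι} {y : Y} (hy : p y = i) :
    glueHomeomorph p q hp hq e y = e i ⟨y, hy⟩ := by
  subst hy; rfl

/-- A space which maps to a discrete space with all fibres homeomorphic to `T` is a product. -/
theorem nonempty_homeomorph_prod {T : Type*} [TopologicalSpace T] (p : Y → ι) (hp : Continuous p)
    (e : ∀ i, Nonempty ({y // p y = i} ≃ₜ T)) : Nonempty (Y ≃ₜ ι × T) := by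
  refine ⟨glueHomeomorph p Prod.fst hp continuous_fst fun i => (e i).some.trans
    { toFun := fun t => ⟨(i, t), rfl⟩
      invFun := fun z => z.1.2
      left_inv := fun _ => rfl
      right_inv := by rintro ⟨⟨_, t⟩, rfl⟩; rfl
      continuous_toFun := by fun_prop
      continuous_invFun := by fun_prop }⟩

end Gluing

/-! ### Decomposition of clopen sets into compact blocks -/

section Blocks

open Topology Filter Set

universe v w

/-- The subspace topology is always finer than the order topology; here it is compact and the other
is Hausdorff, so they agree. No convexity of `K` is needed. -/
theorem IsCompact.orderTopology_coe {X : Type v} [LinearOrder X] [TopologicalSpace X]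
    [OrderTopology X] {K : Set X} (hK : IsCompact K) : OrderTopology K := by
  have hle : (inferInstance : TopologicalSpace K) ≤ Preorder.topology K := by
    refine le_generateFrom ?_
    rintro _ ⟨a, rfl | rfl⟩
    · exact isOpen_Ioi.preimage continuous_subtype_val
    · exact isOpen_Iio.preimage continuous_subtype_val
  refine ⟨le_antisymm hle (continuous_id_iff_le.1 ?_)⟩
  let _ : CompactSpace K := isCompact_iff_compactSpace.1 hK
  let _ : @OrderTopology K (Preorder.topology K) _ := @OrderTopology.mk K (Preorder.topology K) _ rfl
  exact @Continuous.continuous_symm_of_equiv_compact_to_t2 K K _ (Preorder.topology K) _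
    (@OrderClosedTopology.to_t2Space K (Preorder.topology K) _ _) (Equiv.refl K)
    (continuous_id_iff_le.2 hle)

theorem isClopen_Iic_of_wellFoundedLT {L : Type w} [LinearOrder L] [TopologicalSpace L]
    [OrderTopology L] [WellFoundedLT L] (a : L) : IsClopen (Iic a) := by
  refine ⟨isClosed_Iic, ?_⟩
  rcases (Ioi a).eq_empty_or_nonempty with h | h
  · rw [← compl_Ioi, h, compl_empty]
    exact isOpen_univ
  · obtain ⟨b, hb, hmin⟩ := WellFounded.has_min (wellFounded_lt (α := L)) (Ioi a) h
    have : Iic a = Iio b := by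
      ext x
      exact ⟨fun hx => lt_of_le_of_lt hx hb, fun hx => not_lt.1 fun hax => hmin x hax hx⟩
    rw [this]
    exact isOpen_Iio

theorem InitialSeg.isOpenEmbedding_of_forall_le {K : Type v} {L : Type w} [LinearOrder K]
    [LinearOrder L] [TopologicalSpace K] [OrderTopology K] [TopologicalSpace L] [OrderTopology L]
    [WellFoundedLT L] (f : K ≤i L) {m : K} (hm : ∀ x, x ≤ m) :
    IsOpenEmbedding f := by
  have hrange : range f = Iic (f m) := by
    refine Subset.antisymm ?_ fun y hy => f.mem_range_of_le hy
    rintro _ ⟨x, rfl⟩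
    exact f.monotone (hm x)
  refine ⟨f.strictMono.isEmbedding_of_ordConnected (hrange ▸ ordConnected_Iic), ?_⟩
  rw [hrange]
  exact (isClopen_Iic_of_wellFoundedLT _).isOpen

/-- The initial segment embedding is open, so it preserves rank and sends last point to last point;
this makes it surjective. Together with comparability of well-orders it avoids any normal form
computation. -/
theorem InitialSeg.nonempty_homeomorph_of_rankAtLeast_eq {K : Type v} {L : Type w}
    [LinearOrder K] [LinearOrder L] [TopologicalSpace K] [OrderTopology K] [TopologicalSpace L]
    [OrderTopology L] [WellFoundedLT L] (f : K ≤i L) (β : Ordinal.{u}) {m : K} {n : L}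
    (hm : ∀ x, x ≤ m) (hn : ∀ x, x ≤ n) (hK : rankAtLeast K β = {m})
    (hL : rankAtLeast L β = {n}) : Nonempty (K ≃ₜ L) := by
  have hf := f.isOpenEmbedding_of_forall_le hm
  have hmn : f m = n := by
    have : f m ∈ rankAtLeast L β := (hf.mem_rankAtLeast_iff β m).2 (hK ▸ mem_singleton m)
    rwa [hL] at this
  exact ⟨hf.toIsEmbedding.toHomeomorphOfSurjective fun y => f.mem_range_of_le (hmn ▸ hn y)⟩

/-- Two compact well-ordered spaces whose only point of rank at least `β` is the last one are
homeomorphic. -/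
theorem nonempty_homeomorph_of_rankAtLeast_eq {K : Type v} {L : Type w} [LinearOrder K]
    [LinearOrder L] [TopologicalSpace K] [OrderTopology K] [TopologicalSpace L] [OrderTopology L]
    [WellFoundedLT K] [WellFoundedLT L] (β : Ordinal.{u}) {m : K} {n : L}
    (hm : ∀ x, x ≤ m) (hn : ∀ x, x ≤ n) (hK : rankAtLeast K β = {m})
    (hL : rankAtLeast L β = {n}) : Nonempty (K ≃ₜ L) := by
  rcases InitialSeg.total ((· < ·) : K → K → Prop) ((· < ·) : L → L → Prop) with f | f
  · exact f.nonempty_homeomorph_of_rankAtLeast_eq β hm hn hK hL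
  · exact (f.nonempty_homeomorph_of_rankAtLeast_eq β hn hm hL hK).map Homeomorph.symm

/-- The index of the first member of a cofinal increasing sequence above a point is a locally
constant function. -/
theorem exists_continuous_index {X : Type v} [LinearOrder X] [TopologicalSpace X]
    [OrderTopology X] [WellFoundedLT X] (m : ℕ → X) (hm : StrictMono m)
    (hcof : ∀ x, ∃ n, x ≤ m n) :
    ∃ N : X → ℕ, Continuous N ∧ (∀ n, N (m n) = n) ∧ ∀ x, x ≤ m (N x) := by
  classical
  let N : X → ℕ := fun x => Nat.find (hcof x)
  have hN : ∀ x n, N x ≤ n ↔ x ≤ m n := fun x n => by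
    refine ⟨fun h => (Nat.find_spec (hcof x)).trans (hm.monotone h), fun h => Nat.find_min' _ h⟩
  have hclopen : ∀ n, IsClopen {x | N x ≤ n} := fun n => by
    simp only [hN]
    exact isClopen_Iic_of_wellFoundedLT (m n)
  refine ⟨N, ?_, fun n => le_antisymm ((hN _ _).2 le_rfl) ?_, fun x => (hN x _).1 le_rfl⟩
  · refine continuous_discrete_rng.2 fun n => ?_
    cases n with
    | zero =>
      convert (hclopen 0).isOpen using 1
      ext x
      simp
    | succ n =>
      convert ((hclopen (n + 1)).diff (hclopen n)).isOpen using 1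
      ext x
      simp only [mem_preimage, mem_singleton_iff, Set.mem_sdiff, mem_ofPred_eq]
      omega
  · exact hm.le_iff_le.1 ((hN (m n) _).1 le_rfl)

/-- A clopen subset containing infinitely many members of the sequence `m` of points of rank at
least `β` is a disjoint union of countably many copies of the initial segment bounded by `m 0`. -/
theorem nonempty_homeomorph_nat_prod {X : Type v} [LinearOrder X] [TopologicalSpace X]
    [OrderTopology X] [WellFoundedLT X] (hcpt : ∀ x : X, IsCompact (Iic x)) (β : Ordinal.{u})
    (m : ℕ → X) (hm : StrictMono m) (hrange : range m = rankAtLeast X β)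
    (hcof : ∀ x, ∃ n, x ≤ m n) (C : Set X) (hC : IsClopen C)
    (hinf : (C ∩ rankAtLeast X β).Infinite) : Nonempty (C ≃ₜ ℕ × Iic (m 0)) := by
  set E : Set ℕ := {n | m n ∈ C} with hE
  have hEinf : E.Infinite := by
    intro hfin
    refine hinf ((hfin.image m).subset ?_)
    rintro x ⟨hxC, hx⟩
    rw [← hrange] at hx
    obtain ⟨n, rfl⟩ := hx
    exact ⟨n, hxC, rfl⟩
  -- `r` enumerates the indices of the members of the sequence lying in `C`; the fibres in `C` of
  -- the resulting index function are the blocks, each with last point `m (r n)`.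
  let r : ℕ → ℕ := Nat.nth (· ∈ E)
  have hr : StrictMono r := Nat.nth_strictMono hEinf
  have hrE : ∀ n, r n ∈ E := Nat.nth_mem_of_infinite hEinf
  have hrr : range r = E := Nat.range_nth_of_infinite hEinf
  obtain ⟨N, hN, hNr, hNle⟩ := exists_continuous_index (fun n => m (r n)) (hm.comp hr) fun x => by
    obtain ⟨n, hn⟩ := hcof x
    exact ⟨n, hn.trans (hm.monotone (hr.le_apply))⟩
  refine nonempty_homeomorph_prod (fun x : C => N x) (hN.comp continuous_subtype_val) fun n => ?_
  have hKC : IsClopen (C ∩ N ⁻¹' {n}) := hC.inter ((isClopen_discrete {n}).preimage hN)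
  have hKle : ∀ x ∈ C ∩ N ⁻¹' {n}, x ≤ m (r n) := fun x hx => hx.2 ▸ hNle x
  have hmem : m (r n) ∈ C ∩ N ⁻¹' {n} := ⟨hrE n, hNr n⟩
  have hK : IsCompact (C ∩ N ⁻¹' {n}) := (hcpt _).of_isClosed_subset hKC.isClosed hKle
  have h1 : rankAtLeast ↥(C ∩ N ⁻¹' {n}) β = {⟨m (r n), hmem⟩} := by
    ext ⟨x, hx⟩
    rw [← hKC.isOpen.isOpenEmbedding_subtypeVal.mem_rankAtLeast_iff, ← hrange]
    constructor
    · rintro ⟨k, hk⟩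
      obtain ⟨j, rfl⟩ : k ∈ range r := by
        rw [hrr]
        exact (show m k ∈ C from hk ▸ hx.1)
      have hj : j = n := by
        rw [← hNr j]
        exact (congrArg N hk).trans hx.2
      exact Subtype.ext (by rw [← hk, hj])
    · rintro h
      exact ⟨r n, (congrArg Subtype.val h).symm⟩
  have h2 : rankAtLeast ↥(Iic (m 0)) β = {⟨m 0, le_rfl⟩} := by
    ext ⟨x, hx⟩
    have hopen := (isClopen_Iic_of_wellFoundedLT (m 0)).isOpen
    rw [← hopen.isOpenEmbedding_subtypeVal.mem_rankAtLeast_iff, ← hrange]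
    constructor
    · rintro ⟨k, hk⟩
      have : m k ≤ m 0 := hk.trans_le hx
      have hk0 : k = 0 := Nat.le_zero.1 (hm.le_iff_le.1 this)
      exact Subtype.ext (by rw [← hk, hk0])
    · rintro h
      exact ⟨0, (congrArg Subtype.val h).symm⟩
  -- The block need not be convex in `X`, as `C` may have gaps; compactness supplies its order
  -- topology.
  have := hK.orderTopology_coe
  have := (hcpt (m 0)).orderTopology_coe
  obtain ⟨e⟩ := nonempty_homeomorph_of_rankAtLeast_eq β (fun x => hKle x.1 x.2)
    (fun x => x.2) h1 h2
  exact ⟨Homeomorph.trans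
    { toFun := fun x => ⟨x.1.1, x.1.2, x.2⟩
      invFun := fun x => ⟨⟨x.1, x.2.1⟩, x.2.2⟩
      left_inv := fun _ => rfl
      right_inv := fun _ => rfl
      continuous_toFun := by fun_prop
      continuous_invFun := by fun_prop } e⟩

end Blocks

/-! ### Products of conjugates in a group -/

section ConjugateProducts

variable {G : Type u} [Group G]

theorem IsConjProduct.mul {g f₁ f₂ : G} {l₁ l₂ : List G} (h₁ : IsConjProduct g f₁ l₁)
    (h₂ : IsConjProduct g f₂ l₂) : IsConjProduct g (f₁ * f₂) (l₁ ++ l₂) := by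
  refine ⟨fun x hx => ?_, by rw [List.prod_append, h₁.2, h₂.2]⟩
  rcases List.mem_append.1 hx with hx | hx
  exacts [h₁.1 x hx, h₂.1 x hx]

theorem IsConjProduct.conj {g f : G} {l : List G} (h : IsConjProduct g f l) (w : G) :
    IsConjProduct g (w * f * w⁻¹) (l.map (MulAut.conj w)) := by
  refine ⟨fun x hx => ?_, by rw [← map_list_prod, h.2, MulAut.conj_apply]⟩
  obtain ⟨y, hy, rfl⟩ := List.mem_map.1 hx
  have hyw : IsConj y (MulAut.conj w y) := isConj_iff.2 ⟨w, (MulAut.conj_apply w y).symm⟩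
  exact (h.1 y hy).imp (fun k => k.trans hyw) (fun k => k.trans hyw)

/-- If `φ` commutes with the conjugate `h * a⁻¹ * h⁻¹`, then the commutator of `a` and `φ` is the
commutator of `a * h * a⁻¹ * h⁻¹` and `φ`, hence a product of four conjugates of `h` and `h⁻¹`. -/
theorem isConjProduct_commutator {h a φ : G} (hc : Commute (h * a⁻¹ * h⁻¹) φ) :
    IsConjProduct h (a * φ * a⁻¹ * φ⁻¹)
      [a * h * a⁻¹, h⁻¹, φ * h * φ⁻¹, (φ * a) * h⁻¹ * (φ * a)⁻¹] := by
  constructor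
  · intro x hx
    simp only [List.mem_cons, List.not_mem_nil, or_false] at hx
    rcases hx with rfl | rfl | rfl | rfl
    · exact Or.inl (isConj_iff.2 ⟨_, rfl⟩)
    · exact Or.inr (IsConj.refl _)
    · exact Or.inl (isConj_iff.2 ⟨_, rfl⟩)
    · exact Or.inr (isConj_iff.2 ⟨_, rfl⟩)
  · have h1 : h * a⁻¹ * h⁻¹ * φ * (h * a * h⁻¹) = φ := by
      rw [hc.eq]; group
    calc _ = a * (h * a⁻¹ * h⁻¹ * φ * (h * a * h⁻¹)) * a⁻¹ * φ⁻¹ := by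
          simp only [List.prod_cons, List.prod_nil]; group
      _ = _ := by rw [h1]

end ConjugateProducts

/-! ### Commutators of homeomorphisms supported on a displaced set -/

section Extension

open Topology Filter Set

universe v w

theorem Homeomorph.commute_of_forall {X : Type v} [TopologicalSpace X] {c d : X ≃ₜ X}
    (h : ∀ x, c x = x ∨ d x = x) : Commute c d := by
  have := (show Equiv.Perm.Disjoint c.toEquiv d.toEquiv from h).commute
  exact Homeomorph.ext fun x => DFunLike.congr_fun this.eq x

/-- Homeomorphisms between the parts of two partitions into three clopen sets glue. -/
theorem exists_homeomorph_glue {X : Type v} [TopologicalSpace X] {A B C D : Set X}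
    (hA : IsClopen A) (hB : IsClopen B) (hC : IsClopen C) (hD : IsClopen D)
    (hAC : Disjoint A C) (hBD : Disjoint B D) (e₁ : A ≃ₜ B) (e₂ : C ≃ₜ D)
    (e₃ : ↥(A ∪ C)ᶜ ≃ₜ ↥(B ∪ D)ᶜ) :
    ∃ f : X ≃ₜ X, (∀ x : A, f x = e₁ x) ∧ (∀ x : C, f x = e₂ x) ∧
      ∀ x : ↥(A ∪ C)ᶜ, f x = e₃ x := by
  classical
  let idx : Set X → Set X → X → Fin 3 := fun A C x => if x ∈ A then 0 else if x ∈ C then 1 else 2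
  have h0 : ∀ (A C : Set X) (x : X), idx A C x = 0 ↔ x ∈ A := fun A C x => by
    simp only [idx]; split_ifs <;> simp_all
  have h1 : ∀ {A C : Set X}, Disjoint A C → ∀ x, idx A C x = 1 ↔ x ∈ C := fun {A C} hd x => by
    have := fun h : x ∈ A => disjoint_left.1 hd h
    simp only [idx]; split_ifs <;> simp_all
  have h2 : ∀ (A C : Set X) (x : X), idx A C x = 2 ↔ x ∈ (A ∪ C)ᶜ := fun A C x => by
    simp only [idx]; split_ifs <;> simp_all
  have hcont : ∀ {A C : Set X}, IsClopen A → IsClopen C → Disjoint A C →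
      Continuous (idx A C) := fun {A C} hA hC hd => by
    refine continuous_discrete_rng.2 fun i => ?_
    fin_cases i
    · convert hA.isOpen using 1
      exact Set.ext (h0 A C)
    · convert hC.isOpen using 1
      exact Set.ext (h1 hd)
    · convert (hA.union hC).compl.isOpen using 1
      exact Set.ext (h2 A C)
  let r : ∀ {p : X → Prop} {E : Set X}, (∀ x, p x ↔ x ∈ E) → {x // p x} ≃ₜ E :=
    fun h => (Homeomorph.refl X).subtype h
  let e : ∀ i, {x // idx A C x = i} ≃ₜ {x // idx B D x = i} := fun i => match i with
    | 0 => ((r (h0 A C)).trans e₁).trans (r (h0 B D)).symm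
    | 1 => ((r (h1 hAC)).trans e₂).trans (r (h1 hBD)).symm
    | 2 => ((r (h2 A C)).trans e₃).trans (r (h2 B D)).symm
  refine ⟨glueHomeomorph (idx A C) (idx B D) (hcont hA hC hAC) (hcont hB hD hBD) e,
    fun x => ?_, fun x => ?_, fun x => ?_⟩
  · rw [glueHomeomorph_apply _ _ _ _ _ ((h0 A C x).2 x.2)]
    rfl
  · rw [glueHomeomorph_apply _ _ _ _ _ ((h1 hAC x).2 x.2)]
    rfl
  · rw [glueHomeomorph_apply _ _ _ _ _ ((h2 A C x).2 x.2)]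
    rfl

/-- A self-homeomorphism of a clopen subset extends by the identity. -/
theorem exists_homeomorph_extend {X : Type v} [TopologicalSpace X] {A : Set X}
    (hA : IsClopen A) (e : A ≃ₜ A) :
    ∃ f : X ≃ₜ X, (∀ x : A, f x = e x) ∧ ∀ x ∉ A, f x = x := by
  obtain ⟨f, h1, -, h3⟩ := exists_homeomorph_glue hA hA isClopen_empty isClopen_empty
    (disjoint_empty A) (disjoint_empty A) e (.refl _) (.refl _)
  exact ⟨f, h1, fun x hx => h3 ⟨x, by simpa using hx⟩⟩

/-- A self-homeomorphism of `ℤ × Z` supported on the slice over `0` is the commutator of a map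
preserving all slices with the shift. -/
theorem exists_mul_shift_eq {Z : Type v} [TopologicalSpace Z] (g : ℤ × Z ≃ₜ ℤ × Z)
    (hg : ∀ n z, n ≠ 0 → g (n, z) = (n, z)) :
    ∃ a s : ℤ × Z ≃ₜ ℤ × Z, ∀ x, a (s x) = g (s (a x)) := by
  -- A point of slice `0` cannot be sent to another slice, whose points are already fixed; so `g`
  -- restricts to slice `0`.
  have key : ∀ k : ℤ × Z ≃ₜ ℤ × Z, (∀ n z, n ≠ 0 → k (n, z) = (n, z)) →
      ∀ z, k (0, z) = (0, (k (0, z)).2) := fun k hk z => by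
    refine Prod.ext ?_ rfl
    by_contra hne
    have := hk (k (0, z)).1 (k (0, z)).2 hne
    have hz : k (0, z) = (0, z) := k.injective this
    exact hne (by rw [hz])
  have hg' : ∀ n z, n ≠ 0 → g.symm (n, z) = (n, z) := fun n z hn => by
    rw [Homeomorph.symm_apply_eq, hg n z hn]
  let g₀ : Z ≃ₜ Z :=
    { toFun := fun z => (g (0, z)).2
      invFun := fun z => (g.symm (0, z)).2
      left_inv := fun z => by
        change (g.symm (0, (g (0, z)).2)).2 = z
        rw [← key g hg z, g.symm_apply_apply]
      right_inv := fun z => by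
        change (g (0, (g.symm (0, z)).2)).2 = z
        rw [← key g.symm hg' z, g.apply_symm_apply]
      continuous_toFun := by fun_prop
      continuous_invFun := by fun_prop }
  have hpiece : ∀ k : Z ≃ₜ Z, Continuous fun x : ℤ × Z =>
      (x.1, if 0 ≤ x.1 then k x.2 else x.2) := fun k => by
    refine continuous_fst.prodMk (Continuous.if ?_ (by fun_prop) (by fun_prop))
    intro x hx
    have : IsClopen {x : ℤ × Z | 0 ≤ x.1} :=
      (isClopen_discrete (Ici (0 : ℤ))).preimage continuous_fst
    rw [this.frontier_eq] at hx
    exact hx.elim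
  -- `a` applies `g₀` on every slice `n ≥ 0`. Its conjugate by the shift does so on slices `n ≥ 1`,
  -- and the quotient is `g₀` on slice `0` alone.
  let a : ℤ × Z ≃ₜ ℤ × Z :=
    { toFun := fun x => (x.1, if 0 ≤ x.1 then g₀ x.2 else x.2)
      invFun := fun x => (x.1, if 0 ≤ x.1 then g₀.symm x.2 else x.2)
      left_inv := fun x => by
        refine Prod.ext rfl ?_
        dsimp only
        split_ifs <;> simp
      right_inv := fun x => by
        refine Prod.ext rfl ?_
        dsimp only
        split_ifs <;> simp
      continuous_toFun := hpiece g₀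
      continuous_invFun := hpiece g₀.symm }
  refine ⟨a, (Homeomorph.addRight (1 : ℤ)).prodCongr (.refl Z), ?_⟩
  rintro ⟨n, z⟩
  change (n + 1, if 0 ≤ n + 1 then g₀ z else z) = g (n + 1, if 0 ≤ n then g₀ z else z)
  rcases eq_or_ne (n + 1) 0 with h | h
  · rw [if_pos h.ge, if_neg (by omega), h]
    exact (key g hg z).symm
  · rw [hg _ _ h]
    by_cases hn : 0 ≤ n
    · rw [if_pos hn, if_pos (by omega)]
    · rw [if_neg hn, if_neg (by omega)]

/-- If `h` displaces a clopen set `A` which is a union of slices homeomorphic to `Z`, then every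
homeomorphism supported on the slice over `0` is a product of four conjugates of `h` and
`h⁻¹`. -/
theorem exists_isConjProduct_of_slices {X : Type v} [TopologicalSpace X] {Z : Type w}
    [TopologicalSpace Z] {A : Set X} (hA : IsClopen A) (θ : A ≃ₜ ℤ × Z) {h : X ≃ₜ X}
    (hdisp : ∀ x ∈ A, h x ∉ A) {g : X ≃ₜ X}
    (hg : ∀ x, x ∉ range (fun z => (θ.symm (0, z) : X)) → g x = x) :
    ∃ l : List (X ≃ₜ X), l.length = 4 ∧ IsConjProduct h g l := by
  have hgA : ∀ x ∉ A, g x = x := fun x hx => hg x (by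
    rintro ⟨z, rfl⟩
    exact hx (θ.symm (0, z)).2)
  have hmaps : ∀ x, x ∈ A ↔ g x ∈ A := fun x => by
    constructor
    · intro hx
      by_contra hgx
      rw [g.injective (hgA _ hgx)] at hgx
      exact hgx hx
    · intro hgx
      by_contra hx
      exact hx (hgA x hx ▸ hgx)
  let gA : A ≃ₜ A := g.subtype hmaps
  obtain ⟨a', s', has⟩ := exists_mul_shift_eq ((θ.symm.trans gA).trans θ) fun n z hn => by
    have : gA (θ.symm (n, z)) = θ.symm (n, z) := Subtype.ext (hg _ (by
      rintro ⟨z', hz'⟩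
      have := θ.symm.injective (Subtype.ext hz')
      exact hn (congrArg Prod.fst this).symm))
    simp [this]
  obtain ⟨a, ha, haA⟩ := exists_homeomorph_extend hA ((θ.trans a').trans θ.symm)
  obtain ⟨φ, hφ, hφA⟩ := exists_homeomorph_extend hA ((θ.trans s').trans θ.symm)
  have hcomm : a * φ = g * (φ * a) := by
    refine Homeomorph.ext fun x => ?_
    change a (φ x) = g (φ (a x))
    by_cases hx : x ∈ A
    · lift x to A using hx
      rw [hφ, ha, ha, hφ]
      change _ = (gA _ : X)
      congr 1
      have := has (θ x)
      simp only [Homeomorph.trans_apply, Homeomorph.apply_symm_apply] at this ⊢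
      rw [this, Homeomorph.symm_apply_apply]
    · rw [hφA x hx, haA x hx, hφA x hx, hgA x hx]
  have hgeq : g = a * φ * a⁻¹ * φ⁻¹ := by
    rw [hcomm]; group
  -- The first factor is supported on the image of `A` under `h`, the second on `A`, and these are
  -- disjoint.
  have hc : Commute (h * a⁻¹ * h⁻¹) φ := by
    refine Homeomorph.commute_of_forall fun x => ?_
    by_cases hx : x ∈ A
    · left
      have h1 : h.symm x ∉ A := fun h' => hdisp _ h' (by simpa using hx)
      have h2 : a.symm (h.symm x) = h.symm x := by
        rw [Homeomorph.symm_apply_eq, haA _ h1]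
      change h (a.symm (h.symm x)) = x
      rw [h2, h.apply_symm_apply]
    · exact Or.inr (hφA x hx)
  exact ⟨_, rfl, hgeq ▸ isConjProduct_commutator hc⟩

end Extension

/-! ### Normal generation in spaces made of countably many equal blocks -/

section BlockSpaces

open Topology Filter Set

universe v w

/-- `M` is an invariant set of points of `X`, separated by the locally constant function `N`, and
every clopen set containing infinitely many of these points is homeomorphic to `ℕ × T`. -/
structure IsBlockSpace {X : Type v} [TopologicalSpace X] (M : Set X) (N : X → ℕ) (T : Type w)
    [TopologicalSpace T] : Prop where
  continuous_index : Continuous N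
  bijOn_index : BijOn N M univ
  mem_iff_of_isOpenEmbedding : ∀ f : X → X, IsOpenEmbedding f → ∀ x, f x ∈ M ↔ x ∈ M
  nonempty_homeomorph : ∀ C : Set X, IsClopen C → (C ∩ M).Infinite → Nonempty (C ≃ₜ ℕ × T)

namespace IsBlockSpace

variable {X : Type v} [TopologicalSpace X] {M : Set X} {N : X → ℕ} {T : Type w}
  [TopologicalSpace T]

theorem mem_iff (H : IsBlockSpace M N T) (f : X ≃ₜ X) (x : X) : f x ∈ M ↔ x ∈ M :=
  H.mem_iff_of_isOpenEmbedding f f.isOpenEmbedding x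

theorem bijOn (H : IsBlockSpace M N T) (f : X ≃ₜ X) : BijOn f M M := by
  refine ⟨fun x hx => (H.mem_iff f x).2 hx, f.injective.injOn, fun x hx => ?_⟩
  exact ⟨f.symm x, (H.mem_iff f _).1 (by simpa using hx), f.apply_symm_apply x⟩

theorem infinite_preimage_inter (H : IsBlockSpace M N T) {E : Set ℕ} (hE : E.Infinite) :
    (N ⁻¹' E ∩ M).Infinite := by
  intro hfin
  refine hE ((hfin.image N).subset fun n hn => ?_)
  obtain ⟨x, hx, rfl⟩ := H.bijOn_index.surjOn (mem_univ n)
  exact ⟨x, ⟨hn, hx⟩, rfl⟩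

theorem infinite (H : IsBlockSpace M N T) : M.Infinite :=
  (H.infinite_preimage_inter infinite_univ).mono inter_subset_right

theorem nonempty_homeomorph_of_infinite (H : IsBlockSpace M N T) {C D : Set X}
    (hC : IsClopen C) (hD : IsClopen D) (hC' : (C ∩ M).Infinite) (hD' : (D ∩ M).Infinite) :
    Nonempty (C ≃ₜ D) := by
  obtain ⟨e⟩ := H.nonempty_homeomorph C hC hC'
  obtain ⟨e'⟩ := H.nonempty_homeomorph D hD hD'
  exact ⟨e.trans e'.symm⟩

/-- A bijection `ℕ ≃ ℤ × ℕ` turns `ℕ × T` into `ℤ × (ℕ × T)`, and `X` is itself a copy of `ℕ × T`.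
-/
theorem nonempty_homeomorph_int_prod (H : IsBlockSpace M N T) {C : Set X} (hC : IsClopen C)
    (hC' : (C ∩ M).Infinite) : Nonempty (C ≃ₜ ℤ × X) := by
  obtain ⟨e⟩ := H.nonempty_homeomorph C hC hC'
  obtain ⟨e'⟩ := H.nonempty_homeomorph univ isClopen_univ (by simpa using H.infinite)
  let d : ℕ ≃ₜ ℤ × ℕ :=
    (nonempty_equiv_of_countable (α := ℕ) (β := ℤ × ℕ)).some.toHomeomorphOfDiscrete
  exact ⟨(e.trans (d.prodCongr (.refl T))).trans ((Homeomorph.prodAssoc ℤ ℕ T).trans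
    ((Homeomorph.refl ℤ).prodCongr (e'.symm.trans (Homeomorph.Set.univ X))))⟩

/-- The shift of `ℤ × X` has no fixed point. It serves as the element that cannot be reached when
`h` moves only finitely many points of `M`. -/
theorem exists_forall_apply_ne (H : IsBlockSpace M N T) : ∃ f : X ≃ₜ X, ∀ x, f x ≠ x := by
  obtain ⟨e⟩ := H.nonempty_homeomorph_int_prod isClopen_univ (by simpa using H.infinite)
  let e' : X ≃ₜ ℤ × X := (Homeomorph.Set.univ X).symm.trans e
  refine ⟨(e'.trans ((Homeomorph.addRight (1 : ℤ)).prodCongr (.refl X))).trans e'.symm,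
    fun x hx => ?_⟩
  rw [Homeomorph.trans_apply, Homeomorph.symm_apply_eq] at hx
  have : (e' x).1 + 1 = (e' x).1 := congrArg Prod.fst hx
  omega

/-- Clopen sets which, like their complements, contain infinitely many points of `M` are
equivalent under homeomorphisms. -/
theorem exists_homeomorph_mem_iff (H : IsBlockSpace M N T) {A B : Set X} (hA : IsClopen A)
    (hB : IsClopen B) (hA₁ : (A ∩ M).Infinite) (hA₂ : (Aᶜ ∩ M).Infinite)
    (hB₁ : (B ∩ M).Infinite) (hB₂ : (Bᶜ ∩ M).Infinite) :
    ∃ w : X ≃ₜ X, ∀ x, w x ∈ B ↔ x ∈ A := by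
  obtain ⟨e⟩ := H.nonempty_homeomorph_of_infinite hA hB hA₁ hB₁
  obtain ⟨e'⟩ := H.nonempty_homeomorph_of_infinite (hA.union isClopen_empty).compl
    (hB.union isClopen_empty).compl (by simpa using hA₂) (by simpa using hB₂)
  obtain ⟨w, h1, -, h3⟩ := exists_homeomorph_glue hA hB isClopen_empty isClopen_empty
    (disjoint_empty A) (disjoint_empty B) e (.refl _) e'
  refine ⟨w, fun x => ⟨fun hx => ?_, fun hx => ?_⟩⟩
  · by_contra hxA
    have hmem : x ∈ (A ∪ ∅)ᶜ := by simpa using hxA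
    have := h3 ⟨x, hmem⟩
    exact (e' ⟨x, hmem⟩).2 (Or.inl (this ▸ hx))
  · have := h1 ⟨x, hx⟩
    exact this ▸ (e ⟨x, hx⟩).2

end IsBlockSpace

/-- An injective map moving infinitely many points of `M` displaces an infinite subset of `M`. -/
theorem exists_infinite_displaced {X : Type v} {M : Set X} {h : X → X} (hinj : h.Injective)
    (hM : {x ∈ M | h x ≠ x}.Infinite) : ∃ S ⊆ M, S.Infinite ∧ ∀ x ∈ S, h x ∉ S := by
  obtain ⟨S, ⟨hSM, hS⟩, hmax⟩ := zorn_subset {S : Set X | S ⊆ M ∧ ∀ x ∈ S, h x ∉ S} (by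
    intro c hc hchain
    refine ⟨⋃₀ c, ⟨sUnion_subset fun s hs => (hc hs).1, ?_⟩, fun s hs => subset_sUnion_of_mem hs⟩
    rintro x ⟨s, hs, hxs⟩ ⟨t, ht, hxt⟩
    rcases hchain.total hs ht with hst | hts
    · exact (hc ht).2 x (hst hxs) hxt
    · exact (hc hs).2 x hxs (hts hxt))
  refine ⟨S, hSM, fun hfin => ?_, hS⟩
  -- A moved point of `M` outside `S`, its image and its preimage could be added to the maximal `S`;
  -- if `S` is finite, so are these three sets.
  refine hM (((hfin.union (hfin.image h)).union (hfin.preimage hinj.injOn)).subset ?_)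
  rintro x ⟨hxM, hx⟩
  by_contra hcon
  simp only [mem_union, mem_image, mem_preimage, not_or, not_exists, not_and] at hcon
  obtain ⟨⟨h1, h2⟩, h3⟩ := hcon
  refine h1 (hmax (y := insert x S) ⟨insert_subset hxM hSM, ?_⟩ (subset_insert x S)
    (mem_insert x S))
  rintro y (rfl | hy) (hy' | hy')
  · exact hx hy'
  · exact h3 hy'
  · exact h2 y hy hy'
  · exact hS y hy hy'

namespace IsBlockSpace

variable {X : Type v} [TopologicalSpace X] {M : Set X} {N : X → ℕ} {T : Type w}
  [TopologicalSpace T]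

/-- Thicken a displaced infinite `S ⊆ M` to the union `U` of the fibres of `N` through it and remove
the preimage of `U` under `h`. No point of `S` is lost: its image is in `M` but not in `S`, and `N`
is injective on `M`. -/
theorem exists_isClopen_displaced (H : IsBlockSpace M N T) {h : X ≃ₜ X}
    (hM : {x ∈ M | h x ≠ x}.Infinite) :
    ∃ A : Set X, IsClopen A ∧ (A ∩ M).Infinite ∧ ∀ x ∈ A, h x ∉ A := by
  obtain ⟨S, hSM, hSinf, hS⟩ := exists_infinite_displaced h.injective hM
  have hU : IsClopen (N ⁻¹' (N '' S)) := (isClopen_discrete _).preimage H.continuous_index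
  refine ⟨N ⁻¹' (N '' S) \ h ⁻¹' (N ⁻¹' (N '' S)), hU.diff (hU.preimage h.continuous),
    hSinf.mono fun x hx => ⟨⟨⟨x, hx, rfl⟩, ?_⟩, hSM hx⟩, fun x hx hx' => hx.2 hx'.1⟩
  rintro ⟨y, hy, hyx⟩
  have := H.bijOn_index.injOn (hSM hy) ((H.mem_iff h x).2 (hSM hx)) hyx
  exact hS x hx (this ▸ hy)

/-- A homeomorphism which is the identity on a sufficiently large clopen set is a product of four
conjugates of `h` and `h⁻¹`. -/
theorem exists_isConjProduct_of_fixes (H : IsBlockSpace M N T) {h : X ≃ₜ X}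
    (hM : {x ∈ M | h x ≠ x}.Infinite) {C : Set X} (hC : IsClopen C) (hC₁ : (C ∩ M).Infinite)
    (hC₂ : (Cᶜ ∩ M).Infinite) {g : X ≃ₜ X} (hg : ∀ x ∈ C, g x = x) :
    ∃ l : List (X ≃ₜ X), l.length = 4 ∧ IsConjProduct h g l := by
  obtain ⟨A, hA, hAinf, hdisp⟩ := H.exists_isClopen_displaced hM
  obtain ⟨θ⟩ := H.nonempty_homeomorph_int_prod hA hAinf
  -- Each slice is an open copy of `X` inside `X`; invariance of `M` under open embeddings, not just
  -- homeomorphisms, then makes it large.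
  have hslice : ∀ n : ℤ, IsOpenEmbedding (fun x => (θ.symm (n, x) : X)) := fun n => by
    refine hA.isOpen.isOpenEmbedding_subtypeVal.comp (θ.symm.isOpenEmbedding.comp
      (IsOpenEmbedding.of_continuous_injective_isOpenMap (by fun_prop)
        (Prod.mk_right_injective n) fun U hU => ?_))
    rw [← singleton_prod]
    exact (isOpen_discrete {n}).prod hU
  have hinf : ∀ n : ℤ, (range (fun x => (θ.symm (n, x) : X)) ∩ M).Infinite := fun n => by
    refine (H.infinite.image (hslice n).injective.injOn).mono ?_
    rintro _ ⟨x, hx, rfl⟩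
    exact ⟨mem_range_self x, (H.mem_iff_of_isOpenEmbedding _ (hslice n) x).2 hx⟩
  have hclosed : IsClosed (range (fun x => (θ.symm (0, x) : X))) := by
    have : range (fun x => (θ.symm (0, x) : X)) =
        Subtype.val '' (θ.symm '' (Prod.fst ⁻¹' {(0 : ℤ)})) := by
      ext x
      constructor
      · rintro ⟨y, rfl⟩
        exact ⟨_, ⟨(0, y), rfl, rfl⟩, rfl⟩
      · rintro ⟨_, ⟨⟨n, y⟩, hn, rfl⟩, rfl⟩
        obtain rfl : n = 0 := hn
        exact ⟨y, rfl⟩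
    rw [this]
    exact hA.isClosed.isClosedEmbedding_subtypeVal.isClosedMap _
      (θ.symm.isClosedMap _ ((isClosed_discrete {(0 : ℤ)}).preimage continuous_fst))
  -- `w` carries the complement of `C` onto slice `0`, so `w * g * w⁻¹` is supported there. Slice
  -- `1` shows that the complement of slice `0` is large.
  obtain ⟨w, hw⟩ := H.exists_homeomorph_mem_iff hC.compl ⟨hclosed, (hslice 0).isOpen_range⟩ hC₂
    (by rwa [compl_compl]) (hinf 0) ((hinf 1).mono (by
      rintro _ ⟨⟨x, rfl⟩, hx⟩
      refine ⟨?_, hx⟩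
      rintro ⟨y, hy⟩
      have := congrArg Prod.fst (θ.symm.injective (Subtype.ext hy))
      exact absurd this (by norm_num)))
  obtain ⟨l, hl, hlg⟩ := exists_isConjProduct_of_slices hA θ hdisp (g := w * g * w⁻¹) (by
    intro x hx
    change w (g (w.symm x)) = x
    rw [hg, w.apply_symm_apply]
    by_contra hxC
    exact hx (by simpa using (hw (w.symm x)).2 hxC))
  refine ⟨l.map (MulAut.conj w⁻¹), (List.length_map _).trans hl, ?_⟩
  have := hlg.conj w⁻¹
  rwa [show w⁻¹ * (w * g * w⁻¹) * w⁻¹⁻¹ = g by group] at this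

/-- There are disjoint large sets `A`, `C`, `E` such that `f` maps `A` off `C` and `E`. -/
theorem exists_isClopen_avoiding (H : IsBlockSpace M N T) (f : X ≃ₜ X) :
    ∃ A C E : Set X, IsClopen A ∧ IsClopen C ∧ (A ∩ M).Infinite ∧ (C ∩ M).Infinite ∧
      (E ∩ M).Infinite ∧ Disjoint A C ∧ Disjoint A E ∧ Disjoint C E ∧ Disjoint (f '' A) C ∧
      Disjoint (f '' A) E := by
  -- Five classes: `A` lies in class `0`. On infinitely many points of `M` in that class, `f` lands
  -- either in classes `0, 1, 2`, leaving `3` and `4` free for `C` and `E`, or in classes `3, 4`,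
  -- leaving `1` and `2`.
  let U : ℕ → Set X := fun i => N ⁻¹' {n | n % 5 = i}
  have hU : ∀ P : Set ℕ, IsClopen (N ⁻¹' P) := fun P =>
    (isClopen_discrete P).preimage H.continuous_index
  have hUinf : ∀ i < 5, (U i ∩ M).Infinite := fun i hi => by
    refine H.infinite_preimage_inter (infinite_of_injective_forall_mem
      (f := fun k : ℕ => 5 * k + i) (fun a b hab => by dsimp only at hab; omega) fun k => ?_)
    change (5 * k + i) % 5 = i
    omega
  have hdisj : ∀ {P Q : Set ℕ}, Disjoint P Q → Disjoint (N ⁻¹' P) (N ⁻¹' Q) :=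
    fun h => h.preimage N
  have key : ∀ (P : Set ℕ) (i j : ℕ), i < 5 → j < 5 → i ≠ j → i ≠ 0 → j ≠ 0 →
      (∀ n ∈ P, n % 5 ≠ i ∧ n % 5 ≠ j) → ((U 0 ∩ f ⁻¹' (N ⁻¹' P)) ∩ M).Infinite →
      ∃ A C E : Set X, IsClopen A ∧ IsClopen C ∧ (A ∩ M).Infinite ∧ (C ∩ M).Infinite ∧
        (E ∩ M).Infinite ∧ Disjoint A C ∧ Disjoint A E ∧ Disjoint C E ∧ Disjoint (f '' A) C ∧
        Disjoint (f '' A) E := by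
    intro P i j hi hj hij hi0 hj0 hP hinf
    have hne : ∀ {k l : ℕ}, k ≠ l → Disjoint (U k) (U l) := fun hkl =>
      hdisj (disjoint_left.2 fun n (h : n % 5 = _) (h' : n % 5 = _) => hkl (h.symm.trans h'))
    refine ⟨U 0 ∩ f ⁻¹' (N ⁻¹' P), U i, U j, (hU _).inter ((hU P).preimage f.continuous), hU _,
      hinf, hUinf i hi, hUinf j hj, (hne hi0.symm).mono_left inter_subset_left,
      (hne hj0.symm).mono_left inter_subset_left, hne hij, ?_, ?_⟩
    · rw [disjoint_left]
      rintro _ ⟨x, hx, rfl⟩ hx'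
      exact (hP _ hx.2).1 hx'
    · rw [disjoint_left]
      rintro _ ⟨x, hx, rfl⟩ hx'
      exact (hP _ hx.2).2 hx'
  by_cases hinf : ((U 0 ∩ f ⁻¹' (N ⁻¹' {n | n % 5 < 3})) ∩ M).Infinite
  · refine key {n | n % 5 < 3} 3 4 ?_ ?_ ?_ ?_ ?_ (fun n (hn : n % 5 < 3) => ?_) hinf <;> omega
  · refine key {n | n % 5 < 3}ᶜ 1 2 ?_ ?_ ?_ ?_ ?_ (fun n (hn : ¬ n % 5 < 3) => ?_) fun hfin => ?_
    iterate 6 omega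
    refine hUinf 0 (by norm_num) (((not_infinite.1 hinf).union hfin).subset ?_)
    rintro x ⟨hx, hxM⟩
    by_cases hx' : N (f x) % 5 < 3
    · exact Or.inl ⟨⟨hx, hx'⟩, hxM⟩
    · exact Or.inr ⟨⟨hx, hx'⟩, hxM⟩

/-- Every homeomorphism is a product of two homeomorphisms, each of which is the identity on a
large clopen set with large complement. -/
theorem exists_mul_of_fixes (H : IsBlockSpace M N T) (f : X ≃ₜ X) :
    ∃ (u v : X ≃ₜ X) (C D : Set X), f = u * v ∧ (IsClopen C ∧ (C ∩ M).Infinite ∧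
      (Cᶜ ∩ M).Infinite ∧ ∀ x ∈ C, u x = x) ∧ (IsClopen D ∧ (D ∩ M).Infinite ∧
      (Dᶜ ∩ M).Infinite ∧ ∀ x ∈ D, v x = x) := by
  obtain ⟨A, C, E, hA, hC, hAinf, hCinf, hEinf, hAC, hAE, hCE, hfC, hfE⟩ :=
    H.exists_isClopen_avoiding f
  have hB : IsClopen (f '' A) := ⟨f.isClosedMap _ hA.isClosed, f.isOpenMap _ hA.isOpen⟩
  -- Both complements contain `E`, which is what makes them large.
  obtain ⟨e⟩ := H.nonempty_homeomorph_of_infinite (hA.union hC).compl (hB.union hC).compl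
    (hEinf.mono (inter_subset_inter_left M fun x hx => by
      rintro (h | h)
      exacts [disjoint_left.1 hAE h hx, disjoint_left.1 hCE h hx]))
    (hEinf.mono (inter_subset_inter_left M fun x hx => by
      rintro (h | h)
      exacts [disjoint_left.1 hfE h hx, disjoint_left.1 hCE h hx]))
  -- `u` agrees with `f` on `A` and with the identity on `C`, so `u⁻¹ * f` is the identity on `A`.
  obtain ⟨u, hu₁, hu₂, -⟩ := exists_homeomorph_glue hA hB hC hC hAC hfC (f.image A) (.refl C) e
  refine ⟨u, u⁻¹ * f, C, A, by group,
    ⟨hC, hCinf, hEinf.mono (inter_subset_inter_left M hCE.subset_compl_left), fun x hx => ?_⟩,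
    hA, hAinf, hCinf.mono (inter_subset_inter_left M hAC.subset_compl_left), fun x hx => ?_⟩
  · exact hu₂ ⟨x, hx⟩
  · change u.symm (f x) = x
    rw [Homeomorph.symm_apply_eq]
    exact (hu₁ ⟨x, hx⟩).symm

theorem normallyGeneratesWithin (H : IsBlockSpace M N T) {h : X ≃ₜ X}
    (hM : {x ∈ M | h x ≠ x}.Infinite) : NormallyGeneratesWithin h 8 := by
  intro f
  obtain ⟨u, v, C, D, rfl, ⟨hC, hC₁, hC₂, hu⟩, hD, hD₁, hD₂, hv⟩ := H.exists_mul_of_fixes f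
  obtain ⟨l₁, hl₁, h₁⟩ := H.exists_isConjProduct_of_fixes hM hC hC₁ hC₂ hu
  obtain ⟨l₂, hl₂, h₂⟩ := H.exists_isConjProduct_of_fixes hM hD hD₁ hD₂ hv
  exact ⟨l₁ ++ l₂, by simp [hl₁, hl₂], h₁.mul h₂⟩

/-- Moving only finitely many points of `M` is stable under conjugation, inversion and products,
whereas a homeomorphism without fixed points moves all of the infinite set `M`. -/
theorem infinite_moved_of_normallyGenerates (H : IsBlockSpace M N T) {h : X ≃ₜ X}
    (hh : NormallyGenerates h) : {x ∈ M | h x ≠ x}.Infinite := by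
  intro hfin
  let moved : (X ≃ₜ X) → Set X := fun f => {x ∈ M | f x ≠ x}
  have hconj : ∀ g f : X ≃ₜ X, IsConj g f → (moved g).Finite → (moved f).Finite := by
    intro g f hgf hg
    obtain ⟨c, rfl⟩ := isConj_iff.1 hgf
    refine (hg.image c).subset ?_
    rintro x ⟨hxM, hx⟩
    refine ⟨c.symm x, ⟨(H.mem_iff c _).1 (by simpa using hxM), fun hgx => hx ?_⟩,
      c.apply_symm_apply x⟩
    change c (g (c.symm x)) = x
    rw [hgx, c.apply_symm_apply]
  have hinv : (moved h⁻¹).Finite := by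
    refine hfin.subset ?_
    rintro x ⟨hxM, hx⟩
    refine ⟨hxM, fun hhx => hx ?_⟩
    change h.symm x = x
    rw [Homeomorph.symm_apply_eq, hhx]
  obtain ⟨f, hf⟩ := H.exists_forall_apply_ne
  obtain ⟨l, hl, hlf⟩ := hh f
  have hprod : ∀ l : List (X ≃ₜ X), (∀ x ∈ l, IsConj h x ∨ IsConj h⁻¹ x) →
      (moved l.prod).Finite := by
    intro l
    induction l with
    | nil =>
      intro _
      refine finite_empty.subset ?_
      rintro x ⟨-, hx⟩
      exact hx rfl
    | cons g l ih =>
      intro hgl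
      have hg : (moved g).Finite := (hgl g List.mem_cons_self).elim
        (fun k => hconj _ _ k hfin) (fun k => hconj _ _ k hinv)
      refine (hg.union (ih fun x hx => hgl x (List.mem_cons_of_mem g hx))).subset ?_
      rintro x ⟨hxM, hx⟩
      by_cases hlx : l.prod x = x
      · refine Or.inl ⟨hxM, fun hgx => hx ?_⟩
        rw [List.prod_cons]
        change g (l.prod x) = x
        rw [hlx, hgx]
      · exact Or.inr ⟨hxM, hlx⟩
  refine H.infinite ((hprod l hl).subset fun x hx => ⟨hx, ?_⟩)
  rw [hlf]
  exact hf x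

end IsBlockSpace

end BlockSpaces

/-! ### The case of `ω ^ (α + 1)` -/

theorem exists_isBlockSpace_maxRankPoints (α : Ordinal.{u}) :
    ∃ (N : OmegaSucc α → ℕ) (T : Set (OmegaSucc α)), IsBlockSpace (maxRankPoints α) N T := by
  obtain ⟨m, hm, hrange, hcof⟩ := exists_enumeration_maxRankPoints α
  obtain ⟨N, hN, hNm, -⟩ := exists_continuous_index m hm hcof
  have hcpt : ∀ x : OmegaSucc α, IsCompact (Set.Iic x) := fun x => by
    rw [Subtype.isCompact_iff]
    convert isCompact_Icc (a := (0 : Ordinal.{u})) (b := x.1) using 1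
    ext y
    constructor
    · rintro ⟨z, hz, rfl⟩
      exact ⟨zero_le, hz⟩
    · rintro ⟨-, hy⟩
      exact ⟨⟨y, lt_of_le_of_lt hy x.2⟩, hy, rfl⟩
  refine ⟨N, Set.Iic (m 0), hN, ?_, fun f hf x => ?_, fun C hC hinf => ?_⟩
  · rw [← hrange]
    refine ⟨fun _ _ => Set.mem_univ _, ?_, fun n _ => ⟨m n, ⟨n, rfl⟩, hNm n⟩⟩
    rintro _ ⟨i, rfl⟩ _ ⟨j, rfl⟩ hij
    rw [hNm, hNm] at hij
    rw [hij]
  · rw [maxRankPoints_eq_rankAtLeast]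
    exact hf.mem_rankAtLeast_iff α x
  · rw [maxRankPoints_eq_rankAtLeast] at hrange hinf
    exact nonempty_homeomorph_nat_prod hcpt α m hm hrange hcof C hC hinf

theorem mainTheorem1 (α : Ordinal.{u}) (h : OmegaSucc α ≃ₜ OmegaSucc α) :
    Set.BijOn h (maxRankPoints α) (maxRankPoints α) ∧
    List.TFAE [
      NormallyGenerates h,
      UniformlyNormallyGenerates h,
      InducesInfinitePermutation h (maxRankPoints α)] ∧
    (NormallyGenerates h ∨ UniformlyNormallyGenerates h ∨
        InducesInfinitePermutation h (maxRankPoints α) →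
      normalWidth h ≤ 12) := by
  obtain ⟨N, T, H⟩ := exists_isBlockSpace_maxRankPoints α
  have h₁₃ : NormallyGenerates h → InducesInfinitePermutation h (maxRankPoints α) :=
    fun hh => ⟨H.bijOn h, H.infinite_moved_of_normallyGenerates hh⟩
  have h₂₁ : UniformlyNormallyGenerates h → NormallyGenerates h := by
    rintro ⟨k, -, hk⟩ f
    obtain ⟨l, -, hl⟩ := hk f
    exact ⟨l, hl⟩
  have h₃ : InducesInfinitePermutation h (maxRankPoints α) → NormallyGeneratesWithin h 8 :=
    fun hh => H.normallyGeneratesWithin hh.2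
  refine ⟨H.bijOn h, ?_, fun hh => ?_⟩
  · tfae_have 1 → 3 := h₁₃
    tfae_have 2 → 1 := h₂₁
    tfae_have 3 → 2 := fun hh => ⟨8, by norm_num, h₃ hh⟩
    tfae_finish
  -- The argument gives 8, two factors of four conjugates each, which is stronger than 12.
  · have h8 : NormallyGeneratesWithin h 8 :=
      h₃ (hh.elim h₁₃ fun hh => hh.elim (fun k => h₁₃ (h₂₁ k)) id)
    exact (iInf₂_le (8 : ℕ) ⟨by norm_num, h8⟩).trans (by norm_num)
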